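/- Let $\Delta=\{z\in\mathbb{C}:|z|<1\}$ and let $\mathcal{A}$ be the class of analytic functions $f(z)=z+\sum_{n\ge 2}a_nz^n$ on $\Delta$. For analytic functions $F,G$ on $\Delta$ write $F\prec G$ ($F$ is subordinate to $G$) if there is an analytic function $\omega$ on $\Delta$ with $\omega(0)=0$ and $|\omega(z)|<1$ for $z\in\Delta$ such that $F(z)=G(\omega(z))$ for all $z\in\Delta$. Let $\mathcal{SL}^*$ be the class of all $f\in\mathcal{A}$ with $f(z)\neq 0$ for $0<|z|<1$ and $$\frac{zf'(z)}{f(z)}\prec\sqrt{1+z},$$ where the square root is the principal branch and the left-hand side is given the value $1$ at $z=0$. For $f\in\mathcal{A}$ and integers $q,n\ge 1$ let $H_q(n)=\det\,(a_{n+i+j})_{0\le i,j\le q-1}$, where $a_1=1$. **Theorem.** Every $f\in\mathcal{SL}^*$ satisfies $$|H_2(3)|=|a_3a_5-a_4^2|\le\frac1{36}.$$ The bound is sharp: the function $$f(z)=z\exp\left(\int_0^z\frac{\sqrt{1+t^3}-1}{t}\,dt\right)$$ belongs to $\mathcal{SL}^*$ and satisfies $|H_2(3)|=\frac1{36}$.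 -/

import Mathlib

/-- The open unit disk `Δ = {z : |z| < 1}`. -/
def unitDisk : Set ℂ := Metric.ball (0 : ℂ) 1

/-- The class `𝒜` of analytic functions `f(z) = z + a₂ z² + a₃ z³ + ⋯` on the open unit disk.
Functions are total on `ℂ`; only their values in the disk play a role. -/
structure ClassA (f : ℂ → ℂ) : Prop where
  analytic : AnalyticOnNhd ℂ f unitDisk
  map_zero : f 0 = 0
  deriv_zero : deriv f 0 = 1

/-- The Taylor coefficient `aₙ` of `f` at the origin. -/
noncomputable def taylorCoeff (f : ℂ → ℂ) (n : ℕ) : ℂ :=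
  iteratedDeriv n f 0 / (n.factorial : ℂ)

/-- The Hankel determinant `H_q(n) = det (a_{n+i+j})`, `0 ≤ i, j < q`, of `f`. -/
noncomputable def hankelDet (f : ℂ → ℂ) (q n : ℕ) : ℂ :=
  Matrix.det (Matrix.of fun i j : Fin q => taylorCoeff f (n + (i : ℕ) + (j : ℕ)))

/-- A Schwarz function: analytic on the disk, `ω(0) = 0` and `|ω(z)| < 1`. -/
structure IsSchwarz (ω : ℂ → ℂ) : Prop where
  analytic : AnalyticOnNhd ℂ ω unitDisk
  map_zero : ω 0 = 0
  norm_lt_one : ∀ z ∈ unitDisk, ‖ω z‖ < 1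

/-- Subordination `F ≺ G` of analytic functions on the unit disk. -/
def Subordinate (F G : ℂ → ℂ) : Prop :=
  AnalyticOnNhd ℂ F unitDisk ∧ AnalyticOnNhd ℂ G unitDisk ∧
    ∃ ω : ℂ → ℂ, IsSchwarz ω ∧ ∀ z ∈ unitDisk, F z = G (ω z)

/-- The principal branch of the square root, with `sqrt 1 = 1`. -/
noncomputable def principalSqrt (w : ℂ) : ℂ := w ^ (1 / 2 : ℂ)

/-- The function `z f'(z) / f(z)`, with its removable singularity at the origin (where the value
is `1` for `f` in `𝒜`) filled in. -/
noncomputable def starQuotient (f : ℂ → ℂ) (z : ℂ) : ℂ :=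
  if z = 0 then 1 else z * deriv f z / f z

/-- The class `𝒮ℒ*` of those `f` in `𝒜` for which `z f'(z) / f(z) ≺ √(1 + z)`.
The quotient presupposes that `f` has no zero in the punctured disk. -/
structure ClassSLStar (f : ℂ → ℂ) : Prop where
  classA : ClassA f
  ne_zero : ∀ z ∈ unitDisk, z ≠ 0 → f z ≠ 0
  subordinate : Subordinate (starQuotient f) (fun z => principalSqrt (1 + z))

/-- The function `z · exp (∫₀ᶻ (√(1 + t³) - 1) / t dt)`, the integral being taken along the
segment `t = s z`, `0 ≤ s ≤ 1`. The integrand has a removable singularity at `t = 0` with value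
`0`, which is also the value of `0 / 0` in Lean. -/
noncomputable def extremalFunction (z : ℂ) : ℂ :=
  z * Complex.exp (∫ s in (0 : ℝ)..1,
    (principalSqrt (1 + ((s : ℂ) * z) ^ 3) - 1) / ((s : ℂ) * z) * z)

open Filter Topology Metric

/-! Write the Schwarz function as `ω(z) = z φ(z)` with `|φ| ≤ 1` and put `p = z f' / f`. Comparing
coefficients in `z f' = p f` and `p² = 1 + z φ` makes `18432 · H₂(3)` a polynomial in the first four
coefficients of `φ` (`ClassSLStar.hankelDet_eq`). The Schur algorithm bounds these coefficients in
terms of the moduli `x, y, w ∈ [0, 1]` of the first three Schur parameters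
(`IsSchur.exists_norm_taylorCoeff_le`). After the triangle inequality only a polynomial inequality
on the unit cube is left, `hankel_real_bound`, with right-hand side `512 = 18432 / 36`. It is an
equality at `x = y = 0`, `w = 1`, which corresponds to `φ = z²`, that is `ω = z³`, the Schwarz
function of the extremal function. -/

/-! ### The real inequality on the unit cube. -/

theorem quartic_coeff_le {x : ℝ} (h : x ^ 2 ≤ 1) :
    (1 - x ^ 2) ^ 2 * (64 + 2176 * x - 1088 * x ^ 2) ≤ 540 := by
  -- The difference of the two sides is `2720 (x - 2/5)²`. With `v = 1 - x²` it remains to bound `v²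
  -- (2131.2 - 1632 v)`, whose maximum is near `v = 0.87`.
  have h1 : 64 + 2176 * x - 1088 * x ^ 2 ≤ 2131.2 - 1632 * (1 - x ^ 2) := by
    nlinarith [sq_nonneg (x - 4 / 10)]
  have h2 := mul_le_mul_of_nonneg_left h1 (sq_nonneg (1 - x ^ 2))
  have hv0 : 0 ≤ 1 - x ^ 2 := by linarith
  generalize 1 - x ^ 2 = v at *
  nlinarith [mul_nonneg hv0 (sq_nonneg (v - 87 / 100)), sq_nonneg (v - 87 / 100)]

theorem cubic_coeff_ge {x : ℝ} (hx : 0 ≤ x) (h : x ≤ 3 / 10) :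
    40 ≤ (1 - x ^ 2) ^ 2 * (448 - 10432 / 5 * x + 14912 / 5 * x ^ 2 - 7616 / 5 * x ^ 3) := by
  have h4 : 49 ≤ 448 - 10432 / 5 * x + 14912 / 5 * x ^ 2 - 7616 / 5 * x ^ 3 := by
    nlinarith [mul_nonneg (mul_nonneg hx hx) (sub_nonneg.2 h), mul_nonneg hx (sub_nonneg.2 h)]
  have h5 : 82 / 100 ≤ (1 - x ^ 2) ^ 2 := by nlinarith
  nlinarith

theorem quintic_nonneg {x : ℝ} (h : 3 / 10 ≤ x) (hx' : x ≤ 7 / 8) :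
    0 ≤ x * (1024 - 40 * x - 512 * x ^ 2 + 40 * x ^ 3 - 5 * x ^ 4 - 265) -
      (160 + 144 * x - 32 * x ^ 2 - 108 * x ^ 3 - 128 * x ^ 4 - 36 * x ^ 5) := by
  have h1 := sub_nonneg.2 h
  have h2 := sub_nonneg.2 hx'
  nlinarith [mul_nonneg h1 h2, mul_nonneg (mul_nonneg h1 h2) h1, mul_nonneg (mul_nonneg h1 h2) h2,
    mul_nonneg (mul_nonneg h1 h2) (mul_nonneg h1 h2), pow_nonneg (by linarith : 0 ≤ x) 3,
    pow_nonneg (by linarith : 0 ≤ x) 4, pow_nonneg (by linarith : 0 ≤ x) 5]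

theorem sextic_nonneg {x : ℝ} (h : 38 / 100 ≤ x) (hx' : x ≤ 7 / 8) :
    0 ≤ x * (x * (1024 - 40 * x - 512 * x ^ 2 + 40 * x ^ 3 - 5 * x ^ 4 - 265) -
      (160 + 144 * x - 32 * x ^ 2 - 108 * x ^ 3 - 128 * x ^ 4 - 36 * x ^ 5)) +
      86 / 100 * (448 - 10432 / 5 * x + 14912 / 5 * x ^ 2 - 7616 / 5 * x ^ 3) := by
  have h1 := sub_nonneg.2 h
  have h2 := sub_nonneg.2 hx'
  nlinarith [mul_nonneg h1 h2, mul_nonneg (mul_nonneg h1 h2) h1, mul_nonneg (mul_nonneg h1 h2) h2,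
    mul_nonneg (mul_nonneg h1 h2) (mul_nonneg h1 h2), pow_nonneg (by linarith : 0 ≤ x) 3,
    pow_nonneg (by linarith : 0 ≤ x) 4, pow_nonneg (by linarith : 0 ≤ x) 5,
    sq_nonneg (x - 45 / 100), sq_nonneg (x * (x - 45 / 100))]

/-- This is the case `y = 1` of `quadratic_minorant_nonneg`. The cubic factor can be negative only
for `x ≥ 0.38`, and there its weight `(1 - x²)²` may be replaced by the upper bound `0.86`. -/
theorem quintic_add_cubic_nonneg {x : ℝ} (h : 3 / 10 ≤ x) (hx' : x ≤ 7 / 8) :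
    0 ≤ x * (x * (1024 - 40 * x - 512 * x ^ 2 + 40 * x ^ 3 - 5 * x ^ 4 - 265) -
      (160 + 144 * x - 32 * x ^ 2 - 108 * x ^ 3 - 128 * x ^ 4 - 36 * x ^ 5)) +
      (1 - x ^ 2) ^ 2 * (448 - 10432 / 5 * x + 14912 / 5 * x ^ 2 - 7616 / 5 * x ^ 3) := by
  rcases le_total 0 (448 - 10432 / 5 * x + 14912 / 5 * x ^ 2 - 7616 / 5 * x ^ 3) with h5 | h5
  · exact add_nonneg (mul_nonneg (by linarith) (quintic_nonneg h hx'))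
      (mul_nonneg (sq_nonneg _) h5)
  · have h6 : 38 / 100 ≤ x := by
      by_contra! h7
      have := mul_nonneg (sub_nonneg.2 h) (sub_nonneg.2 h7.le)
      nlinarith [mul_nonneg this (sub_nonneg.2 h)]
    have h7 : (1 - x ^ 2) ^ 2 ≤ 86 / 100 := by
      have : 0 ≤ 1 - x ^ 2 := by nlinarith
      have : 1 - x ^ 2 ≤ 86 / 100 := by nlinarith
      nlinarith
    have h8 := mul_le_mul_of_nonpos_right h7 h5
    linarith [sextic_nonneg h6 hx']

theorem quintic_pos {x : ℝ} (hx : 0 ≤ x) (hx1 : x ≤ 1) :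
    0 ≤ 160 + 144 * x - 32 * x ^ 2 - 108 * x ^ 3 - 128 * x ^ 4 - 36 * x ^ 5 := by
  have : x ^ 2 ≤ 1 := pow_le_one₀ hx hx1
  have : x ^ 3 ≤ x := by nlinarith
  have : x ^ 4 ≤ 1 := pow_le_one₀ hx hx1
  have : x ^ 5 ≤ x := by nlinarith [pow_le_one₀ hx hx1 (n := 4)]
  linarith

/-- For small `x` the expression dominates the positive definite form `690 x² - 210 x y + 40 y²`.
For larger `x` it suffices to look at the ends of a segment in `y²`. -/
theorem quadratic_minorant_nonneg {x y : ℝ} (hx : 0 ≤ x) (hx' : x ≤ 7 / 8) (hy : 0 ≤ y)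
    (hy1 : y ≤ 1) :
    0 ≤ x ^ 2 * (1024 - 40 * x - 512 * x ^ 2 + 40 * x ^ 3 - 5 * x ^ 4 - 265) -
      x * (160 + 144 * x - 32 * x ^ 2 - 108 * x ^ 3 - 128 * x ^ 4 - 36 * x ^ 5) * y +
      (1 - x ^ 2) ^ 2 * (448 - 10432 / 5 * x + 14912 / 5 * x ^ 2 - 7616 / 5 * x ^ 3) * y ^ 2 := by
  rcases le_total x (3 / 10) with h | h
  · have p2 : 0 ≤ x ^ 2 := by positivity
    have p3 : 0 ≤ x ^ 3 := by positivity
    have p4 : 0 ≤ x ^ 4 := by positivity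
    have p5 : 0 ≤ x ^ 5 := by positivity
    have h1 : x ^ 2 * 690 ≤
        x ^ 2 * (1024 - 40 * x - 512 * x ^ 2 + 40 * x ^ 3 - 5 * x ^ 4 - 265) := by
      apply mul_le_mul_of_nonneg_left _ p2
      have : x ^ 2 ≤ 9 / 100 := by nlinarith
      have : x ^ 4 ≤ 1 := pow_le_one₀ hx (by linarith)
      linarith
    have h2 : x * (160 + 144 * x - 32 * x ^ 2 - 108 * x ^ 3 - 128 * x ^ 4 - 36 * x ^ 5) ≤
        x * 210 := by
      apply mul_le_mul_of_nonneg_left _ hx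
      linarith
    have h4 := mul_le_mul_of_nonneg_right h2 hy
    have h5 := mul_le_mul_of_nonneg_right (cubic_coeff_ge hx h) (sq_nonneg y)
    have h6 : 0 ≤ 690 * x ^ 2 - 210 * (x * y) + 40 * y ^ 2 := by
      nlinarith [sq_nonneg (3 * x - y)]
    linarith
  -- Replacing `y` by `1` in the negative linear term leaves a function affine in `y²`, so
  -- nonnegativity at `y² = 0` (`h1`) and `y² = 1` (`h2`) is enough.
  · have h1 := mul_nonneg hx (quintic_nonneg h hx')
    have h2 := mul_nonneg (quintic_add_cubic_nonneg h hx') (sq_nonneg y)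
    have h0 := mul_nonneg (mul_nonneg hx (quintic_pos hx (by linarith))) (sub_nonneg.2 hy1)
    have hy2 : 0 ≤ 1 - y ^ 2 := by nlinarith
    linarith [mul_nonneg h1 hy2]

/-- The extremal case `w = 1` of the estimate in `hankel_real_bound`. -/
theorem hankel_real_bound_boundary {x y : ℝ} (hx : 0 ≤ x) (hx1 : x ^ 2 ≤ 3 / 4) (hy : 0 ≤ y)
    (hy1 : y ≤ 1) :
    (4 * ((1 - x ^ 2) * y) + x ^ 2) *
      (144 * ((1 - x ^ 2) * ((1 - y ^ 2) * (y + 2 * x * y) + x ^ 2 * y ^ 3)) +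
        40 * x * ((1 - x ^ 2) * ((1 - y ^ 2) + x * y ^ 2)) +
        x ^ 2 * (16 * ((1 - x ^ 2) * y) + 5 * x ^ 2)) +
      512 * ((1 - x ^ 2) * ((1 - y ^ 2) + x * y ^ 2)) ^ 2 ≤ 512 := by
  have hx' : x ≤ 7 / 8 := by nlinarith
  have hX : 0 ≤ 1 - x ^ 2 := by linarith
  have hx2 : 0 ≤ 1 - x := by linarith
  have hD : 0 ≤ (144 * x ^ 2 * (1 - x ^ 2) * (1 + 2 * x - x ^ 2) +
      160 * x * (1 - x ^ 2) ^ 2 * (1 - x)) * y ^ 3 := by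
    have : 0 ≤ 1 + 2 * x - x ^ 2 := by linarith
    positivity
  -- The first factors form the `y⁴` coefficient of `512 - LHS`. The square trades `y⁴` for `(7/5) x
  -- y² - (49/100) x²`. By `quartic_coeff_le` the loss is at most `(49/100) · 540 x² ≤ 265 x²`, the
  -- `265` of the quadratic minorant; the `y³` terms (`hD`) are dropped.
  have hE : 0 ≤ (1 - x ^ 2) ^ 2 * (64 + 2176 * x - 1088 * x ^ 2) * (y ^ 2 - 7 / 10 * x) ^ 2 := by
    have : 0 ≤ 64 + 2176 * x - 1088 * x ^ 2 := by nlinarith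
    positivity
  have hE1 := mul_le_mul_of_nonneg_left
    (quartic_coeff_le (by linarith : x ^ 2 ≤ 1)) (sq_nonneg x)
  have hC : 0 ≤ 40 * x ^ 3 * (1 - x ^ 2) * (1 - x) * y ^ 2 := by positivity
  linarith [quadratic_minorant_nonneg hx hx' hy hy1, sq_nonneg x]

/-- For `x² ≤ 3/4` the left side is largest at `w = 1`: what the fourth-coefficient term loses as
`w` grows, the final square regains. For `x² ≥ 3/4` the factor `1 - x² ≤ 1/4` makes crude bounds
suffice. -/
theorem hankel_real_bound {x y w : ℝ} (hx : 0 ≤ x) (hx1 : x ≤ 1) (hy : 0 ≤ y) (hy1 : y ≤ 1)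
    (hw : 0 ≤ w) (hw1 : w ≤ 1) :
    (4 * ((1 - x ^ 2) * y) + x ^ 2) *
      (144 * ((1 - x ^ 2) * ((1 - y ^ 2) * (1 - w ^ 2 + y * w ^ 2 + 2 * x * y * w) +
          x ^ 2 * y ^ 3)) +
        40 * x * ((1 - x ^ 2) * ((1 - y ^ 2) * w + x * y ^ 2)) +
        x ^ 2 * (16 * ((1 - x ^ 2) * y) + 5 * x ^ 2)) +
      512 * ((1 - x ^ 2) * ((1 - y ^ 2) * w + x * y ^ 2)) ^ 2 ≤ 512 := by
  have hY : 0 ≤ 1 - y ^ 2 := by nlinarith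
  have hX : 0 ≤ 1 - x ^ 2 := by nlinarith
  have hv1 : (1 - y ^ 2) * w + x * y ^ 2 ≤ (1 - y ^ 2) + x * y ^ 2 := by nlinarith
  have hv0 : 0 ≤ (1 - y ^ 2) * w + x * y ^ 2 := by positivity
  rcases le_total (x ^ 2) (3 / 4) with h | h
  · refine le_trans ?_ (hankel_real_bound_boundary hx h hy hy1)
    have hxw : 0 ≤ 2 * x * y * (1 - w) * (1 - y ^ 2) := by
      have := sub_nonneg.2 hw1
      positivity
    set X := 1 - x ^ 2 with hXd
    set Y := 1 - y ^ 2
    have hU : 0 ≤ 4 * (X * y) + x ^ 2 := by positivity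
    have e1 : 40 * x * (X * (Y * w + x * y ^ 2)) ≤ 40 * x * (X * (Y + x * y ^ 2)) := by gcongr
    have e2 : (4 * (X * y) + x ^ 2) * 144 * (1 - y) * (1 - w ^ 2) ≤
        512 * X * (1 - y ^ 2) * (1 - w ^ 2) := by
      have hw2 : 0 ≤ 1 - w ^ 2 := by nlinarith
      apply mul_le_mul_of_nonneg_right _ hw2
      -- This is what fixes the threshold `3/4`: at `X = 1/4`, `y = 1` it reads `248 ≤ 256`.
      have : (4 * (X * y) + x ^ 2) * 144 ≤ 512 * X * (1 + y) := by nlinarith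
      nlinarith [mul_le_mul_of_nonneg_right this (sub_nonneg.2 hy1)]
    have e3 : 512 * X * (Y * (1 - w ^ 2)) * Y ≤
        512 * X * ((Y + x * y ^ 2) ^ 2 - (Y * w + x * y ^ 2) ^ 2) := by
      have : 0 ≤ X * (Y * (1 - w) * (x * y ^ 2)) := by
        have := sub_nonneg.2 hw1
        positivity
      nlinarith
    have e4 := mul_le_mul_of_nonneg_left e1 hU
    have e5 := mul_le_mul_of_nonneg_left e2 (mul_nonneg hX hY)
    have e6 := mul_le_mul_of_nonneg_left e3 hX
    have e7 := mul_nonneg (mul_nonneg hU hX) hxw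
    change _ ≤ X * Y * (512 * X * Y * (1 - w ^ 2)) at e5
    linarith
  · have hX4 : 1 - x ^ 2 ≤ 1 / 4 := by linarith
    have hY1 : 1 - y ^ 2 ≤ 1 := by linarith [sq_nonneg y]
    have hxX : x ^ 2 + (1 - x ^ 2) = 1 := by ring
    have hv2 : (1 - y ^ 2) * w + x * y ^ 2 ≤ 1 := by
      nlinarith [mul_le_mul_of_nonneg_left hx1 (sq_nonneg y)]
    generalize 1 - x ^ 2 = X at *
    generalize 1 - y ^ 2 = Y at *
    have hx21 : x ^ 2 ≤ 1 := by linarith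
    have b1 : 4 * (X * y) + x ^ 2 ≤ 2 := by nlinarith
    have b2 : Y * (1 - w ^ 2 + y * w ^ 2 + 2 * x * y * w) + x ^ 2 * y ^ 3 ≤ 4 := by
      have c1 : 1 - w ^ 2 + y * w ^ 2 ≤ 1 := by nlinarith
      have c2 : x * y * w ≤ 1 := by
        have : x * y ≤ 1 := by nlinarith
        have : 0 ≤ x * y := by positivity
        nlinarith
      have c3 : 0 ≤ 1 - w ^ 2 + y * w ^ 2 + 2 * x * y * w := by
        have : 0 ≤ 1 - w ^ 2 := by nlinarith
        positivity
      have c4 : y ^ 3 ≤ 1 := pow_le_one₀ hy hy1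
      have c5 : 0 ≤ y ^ 3 := by positivity
      nlinarith
    generalize Y * (1 - w ^ 2 + y * w ^ 2 + 2 * x * y * w) + x ^ 2 * y ^ 3 = S at *
    generalize Y * w + x * y ^ 2 = v at *
    have b3 : X * S ≤ 1 := by nlinarith
    have b4 : X * v ≤ 1 / 4 := by nlinarith
    have b5 : 0 ≤ X * v := by positivity
    have b6 : X * y ≤ 1 / 4 := by nlinarith
    have b7 : x * (X * v) ≤ 1 / 4 := by nlinarith
    have b8 : x ^ 2 * (16 * (X * y) + 5 * x ^ 2) ≤ 9 := by
      have : 0 ≤ X * y := by positivity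
      nlinarith
    have b9 : (X * v) ^ 2 ≤ 1 / 16 := by nlinarith
    have hU : 0 ≤ 4 * (X * y) + x ^ 2 := by positivity
    generalize 4 * (X * y) + x ^ 2 = U at *
    have b10 : 144 * (X * S) + 40 * x * (X * v) + x ^ 2 * (16 * (X * y) + 5 * x ^ 2) ≤ 163 := by
      linarith
    nlinarith

/-! ### Taylor coefficients as formal power series. -/

theorem isOpen_unitDisk : IsOpen unitDisk := isOpen_ball

theorem zero_mem_unitDisk : (0 : ℂ) ∈ unitDisk := mem_ball_self one_pos

theorem unitDisk_mem_nhds_zero : unitDisk ∈ 𝓝 (0 : ℂ) :=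
  isOpen_unitDisk.mem_nhds zero_mem_unitDisk

/-- The Taylor expansion at the origin as a formal power series. -/
noncomputable def taylorSeries (f : ℂ → ℂ) : PowerSeries ℂ := PowerSeries.mk (taylorCoeff f)

theorem coeff_taylorSeries (f : ℂ → ℂ) (n : ℕ) :
    PowerSeries.coeff n (taylorSeries f) = taylorCoeff f n := PowerSeries.coeff_mk _ _

theorem taylorCoeff_zero (f : ℂ → ℂ) : taylorCoeff f 0 = f 0 := by simp [taylorCoeff]

theorem taylorCoeff_one (f : ℂ → ℂ) : taylorCoeff f 1 = deriv f 0 := by simp [taylorCoeff]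

theorem taylorSeries_congr {f g : ℂ → ℂ} (h : Set.EqOn f g unitDisk) :
    taylorSeries f = taylorSeries g := by
  ext n
  have h' : f =ᶠ[𝓝 0] g := by filter_upwards [unitDisk_mem_nhds_zero] with z hz using h hz
  simp only [coeff_taylorSeries, taylorCoeff, h'.iteratedDeriv_eq n]

theorem taylorSeries_mul {f g : ℂ → ℂ} (hf : AnalyticAt ℂ f 0) (hg : AnalyticAt ℂ g 0) :
    taylorSeries (fun z => f z * g z) = taylorSeries f * taylorSeries g := by
  ext n
  rw [PowerSeries.coeff_mul, Finset.Nat.sum_antidiagonal_eq_sum_range_succ_mk, coeff_taylorSeries,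
    taylorCoeff, iteratedDeriv_fun_mul hf.contDiffAt hg.contDiffAt, Finset.sum_div]
  refine Finset.sum_congr rfl fun i hi => ?_
  have hin : i ≤ n := Nat.lt_succ_iff.1 (Finset.mem_range.1 hi)
  simp only [coeff_taylorSeries, taylorCoeff]
  rw [Nat.cast_choose ℂ hin]
  have h1 : (n.factorial : ℂ) ≠ 0 := by exact_mod_cast n.factorial_ne_zero
  have h2 : (i.factorial : ℂ) ≠ 0 := by exact_mod_cast i.factorial_ne_zero
  have h3 : ((n - i).factorial : ℂ) ≠ 0 := by exact_mod_cast (n - i).factorial_ne_zero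
  field_simp

theorem taylorSeries_add {f g : ℂ → ℂ} (hf : AnalyticAt ℂ f 0) (hg : AnalyticAt ℂ g 0) :
    taylorSeries (fun z => f z + g z) = taylorSeries f + taylorSeries g := by
  ext n
  rw [map_add]
  simp only [coeff_taylorSeries, taylorCoeff]
  rw [iteratedDeriv_fun_add hf.contDiffAt hg.contDiffAt, add_div]

theorem taylorSeries_const (c : ℂ) : taylorSeries (fun _ => c) = PowerSeries.C c := by
  ext n
  rw [coeff_taylorSeries, taylorCoeff, iteratedDeriv_const, PowerSeries.coeff_C]
  split_ifs with h <;> simp [h]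

theorem taylorSeries_id : taylorSeries (fun z => z) = PowerSeries.X := by
  ext n
  rw [coeff_taylorSeries, PowerSeries.coeff_X]
  rcases n with _ | _ | n
  · simp [taylorCoeff]
  · simp [taylorCoeff]
  · rw [taylorCoeff, iteratedDeriv_succ', iteratedDeriv_succ']
    simp

theorem taylorCoeff_deriv (f : ℂ → ℂ) (n : ℕ) :
    taylorCoeff (deriv f) n = (n + 1) * taylorCoeff f (n + 1) := by
  simp only [taylorCoeff, iteratedDeriv_succ', Nat.factorial_succ]
  have h1 : (n.factorial : ℂ) ≠ 0 := by exact_mod_cast n.factorial_ne_zero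
  have h2 : (n : ℂ) + 1 ≠ 0 := by exact_mod_cast n.succ_ne_zero
  push_cast
  field_simp

/-! ### Schur functions and their coefficients. -/

/-- Analytic functions on the unit disk bounded by `1`. -/
structure IsSchur (φ : ℂ → ℂ) : Prop where
  analytic : AnalyticOnNhd ℂ φ unitDisk
  norm_le_one : ∀ z ∈ unitDisk, ‖φ z‖ ≤ 1

theorem IsSchur.isSchur_dslope {g : ℂ → ℂ} (hg : IsSchur g) (h0 : g 0 = 0) :
    IsSchur (dslope g 0) where
  analytic := ((Complex.differentiableOn_dslope unitDisk_mem_nhds_zero).2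
    hg.analytic.differentiableOn).analyticOnNhd isOpen_unitDisk
  norm_le_one z hz := by
    have h := Complex.norm_dslope_le_div_of_mapsTo_ball (R₂ := 1) hg.analytic.differentiableOn
      (fun w hw => by simpa [h0] using hg.norm_le_one w hw) hz
    simpa using h

theorem mul_dslope_zero {g : ℂ → ℂ} (h0 : g 0 = 0) (z : ℂ) : z * dslope g 0 z = g z := by
  have h := sub_smul_dslope g 0 z
  simpa [h0] using h

/-- The squares of the two sides differ by `(1 - |a|²)(1 - |w|²)`. -/
theorem norm_sub_le_norm_one_sub {a w : ℂ} (ha : ‖a‖ ≤ 1) (hw : ‖w‖ ≤ 1) :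
    ‖w - a‖ ≤ ‖1 - (starRingEnd ℂ) a * w‖ := by
  have ha2 : ‖a‖ ^ 2 ≤ 1 := pow_le_one₀ (norm_nonneg _) ha
  have hw2 : ‖w‖ ^ 2 ≤ 1 := pow_le_one₀ (norm_nonneg _) hw
  apply le_of_sq_le_sq _ (norm_nonneg _)
  rw [← Complex.normSq_eq_norm_sq] at *
  rw [← Complex.normSq_eq_norm_sq] at *
  simp only [Complex.normSq_apply, Complex.sub_re, Complex.sub_im, Complex.mul_re, Complex.mul_im,
    Complex.conj_re, Complex.conj_im, Complex.one_re, Complex.one_im] at *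
  nlinarith [mul_nonneg (sub_nonneg.2 ha2) (sub_nonneg.2 hw2)]

/-- One step of the Schur algorithm. -/
theorem IsSchur.exists_schur_step {φ : ℂ → ℂ} (hφ : IsSchur φ) :
    ∃ ψ : ℂ → ℂ, IsSchur ψ ∧ ∀ z ∈ unitDisk,
      φ z + (starRingEnd ℂ) (φ 0) * (φ z * (z * ψ z)) = φ 0 + z * ψ z := by
  rcases (hφ.norm_le_one 0 zero_mem_unitDisk).lt_or_eq with h | h
  · have hne : ∀ z ∈ unitDisk, 1 - (starRingEnd ℂ) (φ 0) * φ z ≠ 0 := by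
      intro z hz h0
      have h1 : ‖(starRingEnd ℂ) (φ 0) * φ z‖ < 1 := by
        rw [norm_mul, RCLike.norm_conj]
        exact mul_lt_one_of_nonneg_of_lt_one_left (norm_nonneg _) h (hφ.norm_le_one z hz)
      rw [← sub_eq_zero.1 h0, norm_one] at h1
      exact lt_irrefl _ h1
    set g : ℂ → ℂ := fun z => (φ z - φ 0) / (1 - (starRingEnd ℂ) (φ 0) * φ z) with hg
    have hgS : IsSchur g := by
      refine ⟨fun z hz => ?_, fun z hz => ?_⟩
      · have hz' := hφ.analytic z hz
        exact (hz'.sub analyticAt_const).div (analyticAt_const.sub (analyticAt_const.mul hz'))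
          (hne z hz)
      · rw [hg]
        simp only [norm_div]
        exact div_le_one_of_le₀ (norm_sub_le_norm_one_sub h.le (hφ.norm_le_one z hz))
          (norm_nonneg _)
    have hg0 : g 0 = 0 := by simp [hg]
    refine ⟨dslope g 0, hgS.isSchur_dslope hg0, fun z hz => ?_⟩
    have h1 : g z * (1 - (starRingEnd ℂ) (φ 0) * φ z) = φ z - φ 0 := div_mul_cancel₀ _ (hne z hz)
    rw [mul_dslope_zero hg0]
    linear_combination -h1
  -- If `|φ(0)| = 1`, the maximum principle makes `φ` constant and `ψ = 0` works; the division-free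
  -- form of the identity covers this case.
  · have hconst := Complex.eqOn_of_isPreconnected_of_isMaxOn_norm
      (convex_ball (0 : ℂ) 1).isPreconnected isOpen_unitDisk hφ.analytic.differentiableOn
      zero_mem_unitDisk
      (fun z hz => by simpa [h] using hφ.norm_le_one z hz)
    exact ⟨fun _ => 0, ⟨fun _ _ => analyticAt_const, by simp⟩,
      fun z hz => by simpa using hconst hz⟩

theorem IsSchur.analyticAt_zero {φ : ℂ → ℂ} (hφ : IsSchur φ) : AnalyticAt ℂ φ 0 :=
  hφ.analytic 0 zero_mem_unitDisk

theorem IsSchur.exists_taylorSeries_eq {φ : ℂ → ℂ} (hφ : IsSchur φ) :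
    ∃ ψ : ℂ → ℂ, IsSchur ψ ∧
      taylorSeries φ + PowerSeries.C ((starRingEnd ℂ) (taylorCoeff φ 0)) *
        (PowerSeries.X * (taylorSeries φ * taylorSeries ψ)) =
      PowerSeries.C (taylorCoeff φ 0) + PowerSeries.X * taylorSeries ψ := by
  obtain ⟨ψ, hψ, h⟩ := hφ.exists_schur_step
  refine ⟨ψ, hψ, ?_⟩
  have hf := hφ.analyticAt_zero
  have hp := hψ.analyticAt_zero
  have hi : AnalyticAt ℂ (fun z : ℂ => z) 0 := analyticAt_id
  have hc : ∀ c : ℂ, AnalyticAt ℂ (fun _ : ℂ => c) 0 := fun c => analyticAt_const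
  have e := taylorSeries_congr h
  rw [taylorSeries_add hf ((hc _).fun_mul (hf.fun_mul (hi.fun_mul hp))),
    taylorSeries_mul (hc _) (hf.fun_mul (hi.fun_mul hp)), taylorSeries_mul hf (hi.fun_mul hp),
    taylorSeries_mul hi hp, taylorSeries_add (hc _) (hi.fun_mul hp), taylorSeries_mul hi hp,
    taylorSeries_const, taylorSeries_const, taylorSeries_id] at e
  rw [taylorCoeff_zero, ← e]
  ring

/-- The factor `1 - |φ(0)|²` arises by moving the `φ(0)` term of each convolution to the right;
nothing is divided by it, so it may vanish. -/
theorem IsSchur.exists_taylorCoeff_eq {φ : ℂ → ℂ} (hφ : IsSchur φ) :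
    ∃ ψ : ℂ → ℂ, IsSchur ψ ∧
      taylorCoeff φ 1 = (1 - ‖taylorCoeff φ 0‖ ^ 2 : ℝ) * taylorCoeff ψ 0 ∧
      taylorCoeff φ 2 = (1 - ‖taylorCoeff φ 0‖ ^ 2 : ℝ) * (taylorCoeff ψ 1 -
        (starRingEnd ℂ) (taylorCoeff φ 0) * taylorCoeff ψ 0 ^ 2) ∧
      taylorCoeff φ 3 = (1 - ‖taylorCoeff φ 0‖ ^ 2 : ℝ) * (taylorCoeff ψ 2 -
        2 * (starRingEnd ℂ) (taylorCoeff φ 0) * taylorCoeff ψ 0 * taylorCoeff ψ 1 +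
        (starRingEnd ℂ) (taylorCoeff φ 0) ^ 2 * taylorCoeff ψ 0 ^ 3) := by
  obtain ⟨ψ, hψ, h⟩ := hφ.exists_taylorSeries_eq
  have e : ∀ n, taylorCoeff φ (n + 1) + (starRingEnd ℂ) (taylorCoeff φ 0) *
      ∑ p ∈ Finset.HasAntidiagonal.antidiagonal n, taylorCoeff φ p.1 * taylorCoeff ψ p.2 =
      taylorCoeff ψ n := by
    intro n
    have := congrArg (PowerSeries.coeff (n + 1)) h
    simpa only [map_add, PowerSeries.coeff_C_mul, PowerSeries.coeff_succ_X_mul,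
      PowerSeries.coeff_mul _ (taylorSeries φ), coeff_taylorSeries, PowerSeries.coeff_C,
      Nat.succ_ne_zero, if_false, zero_add] using this
  have hn : (starRingEnd ℂ) (taylorCoeff φ 0) * taylorCoeff φ 0 =
      ((‖taylorCoeff φ 0‖ ^ 2 : ℝ) : ℂ) := by
    rw [RCLike.conj_mul]; simp
  have e0 := e 0
  have e1 := e 1
  have e2 := e 2
  simp only [Finset.Nat.antidiagonal_succ, Finset.Nat.antidiagonal_zero, Finset.sum_cons,
    Finset.map_singleton, Finset.sum_singleton, Finset.map_cons, Function.Embedding.prodMap,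
    Function.Embedding.coeFn_mk, Prod.map, Function.Embedding.refl_apply, zero_add] at e0 e1 e2
  norm_num at e0 e1 e2
  push_cast at hn ⊢
  generalize (starRingEnd ℂ) (taylorCoeff φ 0) = s at *
  rw [← hn]
  have f1 : taylorCoeff φ 1 = (1 - s * taylorCoeff φ 0) * taylorCoeff ψ 0 := by
    linear_combination e0
  have f2 : taylorCoeff φ 2 = (1 - s * taylorCoeff φ 0) * (taylorCoeff ψ 1 -
        s * taylorCoeff ψ 0 ^ 2) := by
    linear_combination e1 - s * taylorCoeff ψ 0 * f1
  refine ⟨ψ, hψ, f1, f2, ?_⟩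
  linear_combination e2 - s * taylorCoeff ψ 1 * f1 - s * taylorCoeff ψ 0 * f2

theorem IsSchur.norm_taylorCoeff_zero_le {φ : ℂ → ℂ} (hφ : IsSchur φ) :
    ‖taylorCoeff φ 0‖ ≤ 1 := by
  rw [taylorCoeff_zero]
  exact hφ.norm_le_one 0 zero_mem_unitDisk

theorem IsSchur.norm_taylorCoeff_one_le {φ : ℂ → ℂ} (hφ : IsSchur φ) :
    ‖taylorCoeff φ 1‖ ≤ 1 - ‖taylorCoeff φ 0‖ ^ 2 := by
  obtain ⟨ψ, hψ, h, -⟩ := hφ.exists_taylorCoeff_eq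
  have h0 : 0 ≤ 1 - ‖taylorCoeff φ 0‖ ^ 2 := by
    have := pow_le_one₀ (norm_nonneg _) hφ.norm_taylorCoeff_zero_le (n := 2)
    linarith
  rw [h, norm_mul, Complex.norm_of_nonneg h0]
  exact mul_le_of_le_one_right h0 hψ.norm_taylorCoeff_zero_le

/-- Bounds for the first four coefficients in terms of the moduli `x`, `y`, `w` of the first three
Schur parameters. -/
theorem IsSchur.exists_norm_taylorCoeff_le {φ : ℂ → ℂ} (hφ : IsSchur φ) :
    ∃ x y w : ℝ, 0 ≤ x ∧ x ≤ 1 ∧ 0 ≤ y ∧ y ≤ 1 ∧ 0 ≤ w ∧ w ≤ 1 ∧ ‖taylorCoeff φ 0‖ = x ∧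
      ‖taylorCoeff φ 1‖ ≤ (1 - x ^ 2) * y ∧
      ‖taylorCoeff φ 2‖ ≤ (1 - x ^ 2) * ((1 - y ^ 2) * w + x * y ^ 2) ∧
      ‖taylorCoeff φ 3‖ ≤ (1 - x ^ 2) *
        ((1 - y ^ 2) * (1 - w ^ 2 + y * w ^ 2 + 2 * x * y * w) + x ^ 2 * y ^ 3) := by
  obtain ⟨ψ, hψ, h1, h2, h3⟩ := hφ.exists_taylorCoeff_eq
  -- Two Schur steps suffice: the next parameter enters only through `|χ₁| ≤ 1 - |χ₀|²`.
  obtain ⟨χ, hχ, k1, k2, -⟩ := hψ.exists_taylorCoeff_eq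
  have hx := hφ.norm_taylorCoeff_zero_le
  have hy := hψ.norm_taylorCoeff_zero_le
  have hw := hχ.norm_taylorCoeff_zero_le
  have hd := hχ.norm_taylorCoeff_one_le
  refine ⟨‖taylorCoeff φ 0‖, ‖taylorCoeff ψ 0‖, ‖taylorCoeff χ 0‖, norm_nonneg _, hx,
    norm_nonneg _, hy, norm_nonneg _, hw, rfl, ?_⟩
  have hX : 0 ≤ 1 - ‖taylorCoeff φ 0‖ ^ 2 := by
    have := pow_le_one₀ (norm_nonneg _) hx (n := 2)
    linarith
  have hY : 0 ≤ 1 - ‖taylorCoeff ψ 0‖ ^ 2 := by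
    have := pow_le_one₀ (norm_nonneg _) hy (n := 2)
    linarith
  have n1 : ‖taylorCoeff ψ 1‖ = (1 - ‖taylorCoeff ψ 0‖ ^ 2) * ‖taylorCoeff χ 0‖ := by
    rw [k1, norm_mul, Complex.norm_of_nonneg hY]
  have n2 : ‖taylorCoeff ψ 2‖ ≤ (1 - ‖taylorCoeff ψ 0‖ ^ 2) *
      (1 - ‖taylorCoeff χ 0‖ ^ 2 + ‖taylorCoeff ψ 0‖ * ‖taylorCoeff χ 0‖ ^ 2) := by
    rw [k2, norm_mul, Complex.norm_of_nonneg hY]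
    refine mul_le_mul_of_nonneg_left ((norm_sub_le _ _).trans ?_) hY
    rw [norm_mul, norm_pow, RCLike.norm_conj]
    linarith
  rw [h1, h2, h3]
  simp only [norm_mul, Complex.norm_of_nonneg hX]
  refine ⟨le_rfl, mul_le_mul_of_nonneg_left ((norm_sub_le _ _).trans ?_) hX,
    mul_le_mul_of_nonneg_left ((norm_add_le _ _).trans
      (add_le_add ((norm_sub_le _ _).trans (add_le_add n2 le_rfl)) le_rfl |>.trans ?_)) hX⟩
  · rw [norm_mul, norm_pow, RCLike.norm_conj, n1]
  · simp only [norm_mul, norm_pow, RCLike.norm_conj, n1, Complex.norm_ofNat]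
    apply le_of_eq
    ring

/-! ### The Hankel determinant through `φ`, and the upper bound. -/

theorem hankelDet_two_three (f : ℂ → ℂ) :
    hankelDet f 2 3 = taylorCoeff f 3 * taylorCoeff f 5 - taylorCoeff f 4 ^ 2 := by
  simp [hankelDet, Matrix.det_fin_two]
  ring

theorem principalSqrt_sq (w : ℂ) : principalSqrt w ^ 2 = w := by
  simp [principalSqrt]

theorem principalSqrt_one : principalSqrt 1 = 1 := by simp [principalSqrt]

theorem analyticAt_principalSqrt_one_add {g : ℂ → ℂ} {z : ℂ} (hg : AnalyticAt ℂ g z)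
    (h : ‖g z‖ < 1) : AnalyticAt ℂ (fun z => principalSqrt (1 + g z)) z :=
  (analyticAt_const.add hg).cpow analyticAt_const (Complex.mem_slitPlane_of_norm_lt_one h)

/-- The Hankel determinant in terms of the coefficients of `ω(z) / z`. -/
theorem hankelDet_eq_of_subordinate {f p φ : ℂ → ℂ} (hf : ClassA f) (hp : AnalyticAt ℂ p 0)
    (hφ : AnalyticAt ℂ φ 0) (hp0 : p 0 = 1) (h1 : ∀ z ∈ unitDisk, z * deriv f z = p z * f z)
    (h2 : ∀ z ∈ unitDisk, p z * p z = 1 + z * φ z) :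
    18432 * hankelDet f 2 3 =
      (4 * taylorCoeff φ 1 + taylorCoeff φ 0 ^ 2) * (144 * taylorCoeff φ 3 -
        40 * taylorCoeff φ 0 * taylorCoeff φ 2 +
        taylorCoeff φ 0 ^ 2 * (16 * taylorCoeff φ 1 - 5 * taylorCoeff φ 0 ^ 2)) -
      512 * taylorCoeff φ 2 ^ 2 := by
  have hfa := hf.analytic 0 zero_mem_unitDisk
  have hi : AnalyticAt ℂ (fun z : ℂ => z) 0 := analyticAt_id
  have e1 := taylorSeries_congr h1
  have e2 := taylorSeries_congr h2
  rw [taylorSeries_mul hi hfa.deriv, taylorSeries_mul hp hfa, taylorSeries_id] at e1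
  rw [taylorSeries_mul hp hp, taylorSeries_add analyticAt_const (hi.fun_mul hφ),
    taylorSeries_mul hi hφ, taylorSeries_id, taylorSeries_const] at e2
  have g1 : ∀ n : ℕ, (n + 1) * taylorCoeff f (n + 1) =
      ∑ q ∈ Finset.HasAntidiagonal.antidiagonal (n + 1), taylorCoeff p q.1 * taylorCoeff f q.2 := by
    intro n
    have := congrArg (PowerSeries.coeff (n + 1)) e1
    simpa only [PowerSeries.coeff_succ_X_mul, PowerSeries.coeff_mul _ (taylorSeries p),
      coeff_taylorSeries, taylorCoeff_deriv] using this
  have g2 : ∀ n : ℕ, ∑ q ∈ Finset.HasAntidiagonal.antidiagonal (n + 1),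
      taylorCoeff p q.1 * taylorCoeff p q.2 = taylorCoeff φ n := by
    intro n
    have := congrArg (PowerSeries.coeff (n + 1)) e2
    simpa [PowerSeries.coeff_succ_X_mul, PowerSeries.coeff_mul _ (taylorSeries p),
      coeff_taylorSeries, PowerSeries.coeff_C] using this
  have f0 : taylorCoeff f 0 = 0 := by rw [taylorCoeff_zero, hf.map_zero]
  have f1 : taylorCoeff f 1 = 1 := by rw [taylorCoeff_one, hf.deriv_zero]
  have p0 : taylorCoeff p 0 = 1 := by rw [taylorCoeff_zero, hp0]
  have a2 := g1 1
  have a3 := g1 2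
  have a4 := g1 3
  have a5 := g1 4
  have p1 := g2 0
  have p2 := g2 1
  have p3 := g2 2
  have p4 := g2 3
  simp only [Finset.Nat.antidiagonal_succ, Finset.Nat.antidiagonal_zero, Finset.sum_cons,
    Finset.map_singleton, Finset.sum_singleton, Finset.map_cons, Function.Embedding.prodMap,
    Function.Embedding.coeFn_mk, Prod.map, Function.Embedding.refl_apply, zero_add] at *
  norm_num [f0, f1, p0] at a2 a3 a4 a5 p1 p2 p3 p4
  -- Both sides are written in the coefficients of `p`: those of `φ` by squaring `p`, so no square
  -- root is expanded, and those of `f` by recursion.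
  rw [hankelDet_two_three, ← p1, ← p2, ← p3, ← p4]
  have b2 : taylorCoeff f 2 = taylorCoeff p 1 := by linear_combination a2
  rw [b2] at a3 a4 a5
  have b3 : taylorCoeff f 3 = (taylorCoeff p 2 + taylorCoeff p 1 ^ 2) / 2 := by
    linear_combination a3 / 2
  rw [b3] at a4 a5
  have b4 : taylorCoeff f 4 = (taylorCoeff p 3 + taylorCoeff p 2 * taylorCoeff p 1 +
      taylorCoeff p 1 * ((taylorCoeff p 2 + taylorCoeff p 1 ^ 2) / 2)) / 3 := by
    linear_combination a4 / 3
  rw [b4] at a5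
  have b5 : taylorCoeff f 5 = (taylorCoeff p 4 + taylorCoeff p 3 * taylorCoeff p 1 +
      taylorCoeff p 2 * ((taylorCoeff p 2 + taylorCoeff p 1 ^ 2) / 2) +
      taylorCoeff p 1 * ((taylorCoeff p 3 + taylorCoeff p 2 * taylorCoeff p 1 +
      taylorCoeff p 1 * ((taylorCoeff p 2 + taylorCoeff p 1 ^ 2) / 2)) / 3)) / 4 := by
    linear_combination a5 / 4
  rw [b3, b4, b5]
  ring

theorem mul_deriv_eq_starQuotient_mul {f : ℂ → ℂ} (h0 : f 0 = 0)
    (hne : ∀ z ∈ unitDisk, z ≠ 0 → f z ≠ 0) :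
    ∀ z ∈ unitDisk, z * deriv f z = starQuotient f z * f z := by
  intro z hz
  rcases eq_or_ne z 0 with rfl | h
  · simp [h0]
  · rw [starQuotient, if_neg h, div_mul_cancel₀ _ (hne z hz h)]

theorem IsSchwarz.isSchur {ω : ℂ → ℂ} (h : IsSchwarz ω) : IsSchur ω :=
  ⟨h.analytic, fun z hz => (h.norm_lt_one z hz).le⟩

/-- The Hankel determinant of a function of class `SL*` with Schwarz function `ω`. -/
theorem ClassSLStar.hankelDet_eq {f ω : ℂ → ℂ} (hf : ClassSLStar f) (hω : IsSchwarz ω)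
    (h : ∀ z ∈ unitDisk, starQuotient f z = principalSqrt (1 + ω z)) :
    18432 * hankelDet f 2 3 =
      (4 * taylorCoeff (dslope ω 0) 1 + taylorCoeff (dslope ω 0) 0 ^ 2) *
        (144 * taylorCoeff (dslope ω 0) 3 -
          40 * taylorCoeff (dslope ω 0) 0 * taylorCoeff (dslope ω 0) 2 +
          taylorCoeff (dslope ω 0) 0 ^ 2 *
            (16 * taylorCoeff (dslope ω 0) 1 - 5 * taylorCoeff (dslope ω 0) 0 ^ 2)) -
      512 * taylorCoeff (dslope ω 0) 2 ^ 2 :=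
  hankelDet_eq_of_subordinate hf.classA (hf.subordinate.1 0 zero_mem_unitDisk)
    (hω.isSchur.isSchur_dslope hω.map_zero).analyticAt_zero (if_pos rfl)
    (mul_deriv_eq_starQuotient_mul hf.classA.map_zero hf.ne_zero)
    (fun z hz => by rw [mul_dslope_zero hω.map_zero, h z hz, ← sq, principalSqrt_sq])

theorem ClassSLStar.norm_hankelDet_le {f : ℂ → ℂ} (hf : ClassSLStar f) :
    ‖hankelDet f 2 3‖ ≤ 1 / 36 := by
  obtain ⟨-, -, ω, hω, h⟩ := hf.subordinate
  have e := hf.hankelDet_eq hω h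
  obtain ⟨x, y, w, hx, hx1, hy, hy1, hw, hw1, n0, n1, n2, n3⟩ :=
    (hω.isSchur.isSchur_dslope hω.map_zero).exists_norm_taylorCoeff_le
  have hb := hankel_real_bound hx hx1 hy hy1 hw hw1
  generalize taylorCoeff (dslope ω 0) 0 = c1 at *
  generalize taylorCoeff (dslope ω 0) 1 = c2 at *
  generalize taylorCoeff (dslope ω 0) 2 = c3 at *
  generalize taylorCoeff (dslope ω 0) 3 = c4 at *
  have hu : ‖4 * c2 + c1 ^ 2‖ ≤ 4 * ((1 - x ^ 2) * y) + x ^ 2 := by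
    refine (norm_add_le _ _).trans ?_
    rw [norm_mul, norm_pow, n0, Complex.norm_ofNat]
    linarith
  have hv : ‖16 * c2 - 5 * c1 ^ 2‖ ≤ 16 * ((1 - x ^ 2) * y) + 5 * x ^ 2 := by
    refine (norm_sub_le _ _).trans ?_
    rw [norm_mul, norm_mul, norm_pow, n0, Complex.norm_ofNat, Complex.norm_ofNat]
    linarith
  have h3 : ‖40 * c1 * c3‖ ≤ 40 * x * ((1 - x ^ 2) * ((1 - y ^ 2) * w + x * y ^ 2)) := by
    rw [norm_mul, norm_mul, n0, Complex.norm_ofNat]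
    gcongr
  have h4 : ‖144 * c4 - 40 * c1 * c3 + c1 ^ 2 * (16 * c2 - 5 * c1 ^ 2)‖ ≤
      144 * ((1 - x ^ 2) * ((1 - y ^ 2) * (1 - w ^ 2 + y * w ^ 2 + 2 * x * y * w) +
        x ^ 2 * y ^ 3)) +
      40 * x * ((1 - x ^ 2) * ((1 - y ^ 2) * w + x * y ^ 2)) +
      x ^ 2 * (16 * ((1 - x ^ 2) * y) + 5 * x ^ 2) := by
    refine (norm_add_le _ _).trans (add_le_add ((norm_sub_le _ _).trans (add_le_add ?_ h3)) ?_)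
    · rw [norm_mul, Complex.norm_ofNat]
      gcongr
    · rw [norm_mul, norm_pow, n0]
      gcongr
  have key : ‖18432 * hankelDet f 2 3‖ ≤ 512 := by
    rw [e]
    refine (norm_sub_le _ _).trans (le_trans ?_ hb)
    rw [norm_mul, norm_mul 512, norm_pow, Complex.norm_ofNat]
    gcongr
    exact (norm_nonneg _).trans hu
  rw [norm_mul, Complex.norm_ofNat] at key
  linarith

/-! ### The extremal function and sharpness. -/

theorem norm_cube_lt_one {z : ℂ} (hz : z ∈ unitDisk) : ‖z ^ 3‖ < 1 := by
  rw [norm_pow]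
  exact pow_lt_one₀ (norm_nonneg _) (mem_ball_zero_iff.1 hz) three_ne_zero

theorem isSchwarz_cube : IsSchwarz (fun z => z ^ 3) :=
  ⟨fun _ _ => analyticAt_id.pow 3, by simp, fun _ hz => norm_cube_lt_one hz⟩

theorem analyticOnNhd_principalSqrt_one_add_cube :
    AnalyticOnNhd ℂ (fun z => principalSqrt (1 + z ^ 3)) unitDisk := fun _ hz =>
  analyticAt_principalSqrt_one_add (analyticAt_id.pow 3) (norm_cube_lt_one hz)

/-- The quotient `(√(1 + t³) - 1) / t`, with value `0` at the origin, has a removable singularity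
there. -/
theorem dslope_principalSqrt_eq (t : ℂ) :
    dslope (fun z => principalSqrt (1 + z ^ 3)) 0 t = (principalSqrt (1 + t ^ 3) - 1) / t := by
  rcases eq_or_ne t 0 with rfl | ht
  · have h : HasDerivAt (fun z : ℂ => principalSqrt (1 + z ^ 3)) 0 0 := by
      have h1 : HasDerivAt (fun z : ℂ => 1 + z ^ 3) 0 0 := by
        simpa using ((hasDerivAt_id (0 : ℂ)).pow 3).const_add 1
      have h2 := h1.cpow_const (c := (1 / 2 : ℂ)) (by simp)
      simpa [principalSqrt] using h2
    simp [dslope_same, h.deriv]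
  · rw [dslope_of_ne _ ht, slope_def_field]
    simp [principalSqrt_one]

/-- After filling in the singularity the integrand is holomorphic on the disk, so it has a primitive
`F`; the fundamental theorem of calculus along the segment identifies the integral with `F z`. -/
theorem exists_extremalFunction_eq : ∃ F : ℂ → ℂ, F 0 = 0 ∧
    (∀ z ∈ unitDisk, HasDerivAt F ((principalSqrt (1 + z ^ 3) - 1) / z) z) ∧
    ∀ z ∈ unitDisk, extremalFunction z = z * Complex.exp (F z) := by
  have hG : DifferentiableOn ℂ (dslope (fun z => principalSqrt (1 + z ^ 3)) 0) unitDisk :=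
    (Complex.differentiableOn_dslope unitDisk_mem_nhds_zero).2
      analyticOnNhd_principalSqrt_one_add_cube.differentiableOn
  obtain ⟨F, hF0, hF⟩ := hG.isExactOn_ball.with_val_at 0 0
  refine ⟨F, hF0, fun z hz => by simpa only [dslope_principalSqrt_eq] using hF z hz, fun z hz => ?_⟩
  have hmem : ∀ s ∈ Set.uIcc (0 : ℝ) 1, (s : ℂ) * z ∈ unitDisk := by
    intro s hs
    rw [Set.uIcc_of_le zero_le_one] at hs
    have hz' : ‖z‖ < 1 := mem_ball_zero_iff.1 hz
    rw [unitDisk, mem_ball_zero_iff, norm_mul, Complex.norm_of_nonneg hs.1]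
    exact (mul_le_of_le_one_left (norm_nonneg _) hs.2).trans_lt hz'
  have hint : ∫ s in (0 : ℝ)..1,
      (principalSqrt (1 + ((s : ℂ) * z) ^ 3) - 1) / ((s : ℂ) * z) * z = F z := by
    have hderiv : ∀ s ∈ Set.uIcc (0 : ℝ) 1, HasDerivAt (fun s : ℝ => F ((s : ℂ) * z))
        ((principalSqrt (1 + ((s : ℂ) * z) ^ 3) - 1) / ((s : ℂ) * z) * z) s := by
      intro s hs
      have h1 := hF _ (hmem s hs)
      rw [dslope_principalSqrt_eq] at h1
      have h2 : HasDerivAt (fun s : ℝ => (s : ℂ) * z) z s := by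
        simpa using (Complex.ofRealCLM.hasDerivAt (x := s)).mul_const z
      exact h1.comp s h2
    rw [intervalIntegral.integral_eq_sub_of_hasDerivAt hderiv]
    · simp [hF0]
    · apply ContinuousOn.intervalIntegrable
      simp only [← dslope_principalSqrt_eq]
      exact (hG.continuousOn.comp (by fun_prop) hmem).mul continuousOn_const
  rw [extremalFunction, hint]

theorem starQuotient_extremalFunction {z : ℂ} (hz : z ∈ unitDisk) :
    starQuotient extremalFunction z = principalSqrt (1 + z ^ 3) := by
  rcases eq_or_ne z 0 with rfl | h0
  · simp [starQuotient, principalSqrt_one]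
  obtain ⟨F, -, hF, hE⟩ := exists_extremalFunction_eq
  have hE' : extremalFunction =ᶠ[𝓝 z] fun z => z * Complex.exp (F z) := by
    filter_upwards [isOpen_unitDisk.mem_nhds hz] with w hw using hE w hw
  have hd := (hasDerivAt_id z).mul (hF z hz).cexp
  rw [starQuotient, if_neg h0, hE'.deriv_eq, hE z hz]
  have hd' : deriv (fun z => z * Complex.exp (F z)) z = _ := hd.deriv
  rw [hd']
  have := Complex.exp_ne_zero (F z)
  simp only [id]
  field_simp
  ring

theorem classA_extremalFunction : ClassA extremalFunction := by
  obtain ⟨F, hF0, hF, hE⟩ := exists_extremalFunction_eq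
  have hFd : DifferentiableOn ℂ F unitDisk := fun z hz =>
    (hF z hz).differentiableAt.differentiableWithinAt
  have hd : DifferentiableOn ℂ extremalFunction unitDisk :=
    (differentiableOn_id.mul hFd.cexp).congr hE
  refine ⟨hd.analyticOnNhd isOpen_unitDisk, by simp [extremalFunction], ?_⟩
  have hE' : extremalFunction =ᶠ[𝓝 0] fun z => z * Complex.exp (F z) := by
    filter_upwards [unitDisk_mem_nhds_zero] with w hw using hE w hw
  have h0 := (hasDerivAt_id (0 : ℂ)).mul (hF 0 zero_mem_unitDisk).cexp
  have h1 : deriv (fun z => z * Complex.exp (F z)) 0 = _ := h0.deriv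
  rw [hE'.deriv_eq, h1]
  simp [hF0]

theorem classSLStar_extremalFunction : ClassSLStar extremalFunction where
  classA := classA_extremalFunction
  ne_zero _ _ h0 := mul_ne_zero h0 (Complex.exp_ne_zero _)
  subordinate := by
    refine ⟨fun z hz => ?_, fun z hz => ?_, fun z => z ^ 3, isSchwarz_cube,
      fun z hz => starQuotient_extremalFunction hz⟩
    · refine (analyticOnNhd_principalSqrt_one_add_cube z hz).congr ?_
      filter_upwards [isOpen_unitDisk.mem_nhds hz] with w hw
      exact (starQuotient_extremalFunction hw).symm
    · exact analyticAt_principalSqrt_one_add analyticAt_id (mem_ball_zero_iff.1 hz)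

theorem taylorSeries_dslope_cube :
    taylorSeries (dslope (fun z : ℂ => z ^ 3) 0) = PowerSeries.X ^ 2 := by
  have hi : AnalyticAt ℂ (fun z : ℂ => z) 0 := analyticAt_id
  rw [← taylorSeries_id, sq, ← taylorSeries_mul hi hi]
  refine taylorSeries_congr fun z _ => ?_
  rcases eq_or_ne z 0 with rfl | h
  · simp
  · rw [dslope_of_ne _ h, slope_def_field]
    field_simp
    simp [pow_succ]

theorem norm_hankelDet_extremalFunction : ‖hankelDet extremalFunction 2 3‖ = 1 / 36 := by
  have e := classSLStar_extremalFunction.hankelDet_eq isSchwarz_cube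
    (fun z hz => starQuotient_extremalFunction hz)
  -- Since `φ = z²`, only the term `-512 · 1²` survives.
  simp only [← coeff_taylorSeries, taylorSeries_dslope_cube, PowerSeries.coeff_X_pow] at e
  norm_num at e
  have : hankelDet extremalFunction 2 3 = -(1 / 36) := by linear_combination e / 18432
  rw [this]
  norm_num

theorem theorem2p2 :
    (∀ f : ℂ → ℂ, ClassSLStar f →
      hankelDet f 2 3 = taylorCoeff f 3 * taylorCoeff f 5 - taylorCoeff f 4 ^ 2 ∧
      ‖hankelDet f 2 3‖ ≤ 1 / 36) ∧
    (ClassSLStar extremalFunction ∧ ‖hankelDet extremalFunction 2 3‖ = 1 / 36) :=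
  ⟨fun f hf => ⟨hankelDet_two_three f, hf.norm_hankelDet_le⟩,
    classSLStar_extremalFunction, norm_hankelDet_extremalFunction⟩
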